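/- Let $\Theta\subseteq\mathbb{R}^k$ be open and let $\{p_\theta:\theta\in\Theta\}$ be probability densities with respect to a measure $\mu$, with distributions $P_\theta$; write $P_\theta^n$ for the law of $n$ i.i.d. observations and $\ell(\theta)=\sum_{i\le n}\log p_\theta(X_i)$. Suppose the model is doubly differentiable in quadratic mean (DDQM) at $\theta\in\Theta$: there are measurable score functions $\dot\ell_{\theta'}$ such that for all sequences $h,\tilde h\to0$, $$\int\Bigl(\sqrt{p_{\theta+h}}-\sqrt{p_{\theta+\tilde h}}-\tfrac12(h-\tilde h)^T\dot\ell_{\theta+\tilde h}\sqrt{p_{\theta+\tilde h}}\Bigr)^2d\mu=o(\|h-\tilde h\|^2).$$ Let $\mathcal M_1,\mathcal M_2\subseteq\Theta$ and $c>0$. For $\theta\in\mathcal M_1\cap\mathcal M_2$ let $D_\varepsilon$ be the Hausdorff distance between $\mathcal M_1\cap N_\varepsilon(\theta)$ and $\mathcal M_2\cap N_\varepsilon(\theta)$, where $N_\varepsilon(\theta)$ is the $\varepsilon$-ball around $\theta$. The models are $c$-equivalent at $\theta$ if $D_\varepsilon=o(\varepsilon^c)$, and $c$-near-equivalent at $\theta$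 if $D_\varepsilon=O(\varepsilon^c)$, as $\varepsilon\downarrow0$. Say that $\mathcal M_1,\mathcal M_2$ cannot be asymptotically distinguished under local alternatives to $\theta$ of order $O(r_n)$ (respectively $o(r_n)$) if for every sequence $h_n=O(r_n)$ (respectively $o(r_n)$) with $\theta+h_n\in\mathcal M_1$ for all $n$ there is a sequence $\tilde h_n$ of the same order with $\theta+\tilde h_n\in\mathcal M_2$ for all $n$ such that (i) $E_{P_{\theta+h_n}^n}\varphi_n-E_{P_{\theta+\tilde h_n}^n}\varphi_n\to0$ for every sequence of tests $\varphi_n$ (measurable $[0,1]$-valued functions of $n$ observations), and (ii) $\ell(\theta+h_n)-\ell(\theta+\tilde h_n)\to0$ in $P_{\theta+\tilde h_n}^n$-probability; and if the same holds with $\mathcal M_1$ and $\mathcal M_2$ exchanged. Then: 1. If $\mathcal M_1,\mathcal M_2$ are $c$-equivalent at $\theta$, they cannot be asymptotically distinguished under local alternatives to $\theta$ of order $O(n^{-1/(2c)})$. 2. If $\mathcal M_1,\mathcal M_2$ are $c$-near-equivalent at $\theta$, they cannot be asymptotically distinguished under local alternatives to $\theta$ of order $o(n^{-1/(2c)})$.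 3. For example, if $\mathcal M_1,\mathcal M_2$ are 1-equivalent at $\theta$ and near $\theta$ both are twice continuously differentiable embedded submanifolds of $\mathbb R^k$, they cannot be asymptotically distinguished under local alternatives to $\theta$ of order $o(n^{-1/4})$; that is, effects of order $n^{-1/4}$ or larger are required. -/

import Mathlib

open Filter Topology MeasureTheory Asymptotics

/-- A dominated parametric statistical model: an open parameter set `Θ ⊆ ℝᵏ` and, for every
`θ ∈ Θ`, a probability density `p_θ` with respect to a common measure `μ` on the sample space. -/
structure DominatedModel (k : ℕ) (X : Type*) [MeasurableSpace X] where
  Θ : Set (EuclideanSpace ℝ (Fin k))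
  isOpen_Θ : IsOpen Θ
  μ : Measure X
  density : EuclideanSpace ℝ (Fin k) → X → ℝ
  measurable_density : ∀ θ ∈ Θ, Measurable (density θ)
  density_nonneg : ∀ θ ∈ Θ, ∀ x, 0 ≤ density θ x
  lintegral_density : ∀ θ ∈ Θ, ∫⁻ x, ENNReal.ofReal (density θ x) ∂μ = 1

namespace DominatedModel

variable {k : ℕ} {X : Type*} [MeasurableSpace X]

/-- The distribution `P_θ` of one observation. -/
noncomputable def law (m : DominatedModel k X) (θ : EuclideanSpace ℝ (Fin k)) : Measure X :=
  m.μ.withDensity fun x => ENNReal.ofReal (m.density θ x)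

/-- The joint distribution of `n` independent observations from `P_θ`. -/
noncomputable def sampleLaw (m : DominatedModel k X) (n : ℕ) (θ : EuclideanSpace ℝ (Fin k)) :
    Measure (Fin n → X) :=
  Measure.pi fun _ => m.law θ

/-- The log-likelihood of a sample of size `n` (meaningful where all densities are positive). -/
noncomputable def logLik (m : DominatedModel k X) {n : ℕ} (θ : EuclideanSpace ℝ (Fin k))
    (x : Fin n → X) : ℝ :=
  ∑ i, Real.log (m.density θ (x i))

/-- The integrand in the definition of double differentiability in quadratic mean:
`(√p_{θ+h} - √p_{θ+h'} - ½ (h - h')ᵀ s(θ + h') √p_{θ+h'})²`, where `s` is the score. -/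
noncomputable def ddqmRemainder (m : DominatedModel k X)
    (s : EuclideanSpace ℝ (Fin k) → X → EuclideanSpace ℝ (Fin k))
    (θ h h' : EuclideanSpace ℝ (Fin k)) (x : X) : ℝ :=
  (Real.sqrt (m.density (θ + h) x) - Real.sqrt (m.density (θ + h') x)
    - 1 / 2 * inner ℝ (h - h') (s (θ + h') x) * Real.sqrt (m.density (θ + h') x)) ^ 2

/-- The model is doubly differentiable in quadratic mean at `θ ∈ Θ`. -/
def DDQMAt (m : DominatedModel k X) (θ : EuclideanSpace ℝ (Fin k)) : Prop :=
  θ ∈ m.Θ ∧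
  ∃ s : EuclideanSpace ℝ (Fin k) → X → EuclideanSpace ℝ (Fin k),
    (∀ θ' ∈ m.Θ, Measurable (s θ')) ∧
    ∀ h h' : ℕ → EuclideanSpace ℝ (Fin k),
      Tendsto h atTop (𝓝 0) → Tendsto h' atTop (𝓝 0) →
        (∀ᶠ n in atTop, Integrable (m.ddqmRemainder s θ (h n) (h' n)) m.μ) ∧
        (fun n => ∫ x, m.ddqmRemainder s θ (h n) (h' n) x ∂m.μ)
          =o[atTop] fun n => ‖h n - h' n‖ ^ 2

/-- Two sequences of parameter values, `n` being the sample size, are asymptotically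
indistinguishable: no sequence of (randomized) tests `φ n` based on `n` independent observations
has rejection probabilities under the two sequences that stay apart, and the difference of the
log-likelihoods tends to zero in probability under the second sequence (with probability tending
to one, both log-likelihoods are finite and they differ by less than `δ`). -/
def AsympIndistinguishable (m : DominatedModel k X)
    (θ₁ θ₂ : ℕ → EuclideanSpace ℝ (Fin k)) : Prop :=
  (∀ φ : (n : ℕ) → (Fin n → X) → ℝ,
    (∀ n, Measurable (φ n)) → (∀ n x, φ n x ∈ Set.Icc (0 : ℝ) 1) →
      Tendsto (fun n => ∫ x, φ n x ∂(m.sampleLaw n (θ₁ n)) - ∫ x, φ n x ∂(m.sampleLaw n (θ₂ n)))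
        atTop (𝓝 0)) ∧
  (∀ δ : ℝ, 0 < δ →
    Tendsto
      (fun n => m.sampleLaw n (θ₂ n)
        {x | (∀ i, 0 < m.density (θ₁ n) (x i) ∧ 0 < m.density (θ₂ n) (x i)) ∧
          |m.logLik (θ₁ n) x - m.logLik (θ₂ n) x| < δ})
      atTop (𝓝 1))

/-- Every sequence of local alternatives `θ + h_n` in `A` whose deviations have the given order is
asymptotically indistinguishable from some sequence of local alternatives in `B` whose deviations
have that order too. -/
def LocallyMimicked (m : DominatedModel k X) (A B : Set (EuclideanSpace ℝ (Fin k)))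
    (θ : EuclideanSpace ℝ (Fin k)) (order : (ℕ → EuclideanSpace ℝ (Fin k)) → Prop) : Prop :=
  ∀ h : ℕ → EuclideanSpace ℝ (Fin k), order h → (∀ n, θ + h n ∈ A) →
    ∃ h' : ℕ → EuclideanSpace ℝ (Fin k), order h' ∧ (∀ n, θ + h' n ∈ B) ∧
      m.AsympIndistinguishable (fun n => θ + h n) (fun n => θ + h' n)

/-- The submodels `A` and `B` cannot be asymptotically distinguished under local alternatives to
`θ` of the given order, whichever of the two submodels is the true one. -/
def CannotDistinguish (m : DominatedModel k X) (A B : Set (EuclideanSpace ℝ (Fin k)))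
    (θ : EuclideanSpace ℝ (Fin k)) (order : (ℕ → EuclideanSpace ℝ (Fin k)) → Prop) : Prop :=
  m.LocallyMimicked A B θ order ∧ m.LocallyMimicked B A θ order

end DominatedModel

/-- `A` and `B` are `c`-equivalent at `θ ∈ A ∩ B`: the Hausdorff distance of their traces on the
`ε`-ball around `θ` is `o(ε^c)`. (Both traces contain `θ`, so this distance is finite.) -/
def CEquivalentAt {k : ℕ} (c : ℝ) (A B : Set (EuclideanSpace ℝ (Fin k)))
    (θ : EuclideanSpace ℝ (Fin k)) : Prop :=
  θ ∈ A ∩ B ∧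
  Tendsto
    (fun ε : ℝ => ε ^ (-c) * Metric.hausdorffDist (A ∩ Metric.ball θ ε) (B ∩ Metric.ball θ ε))
    (𝓝[>] 0) (𝓝 0)

/-- `A` and `B` are `c`-near-equivalent at `θ ∈ A ∩ B`: the same distance is `O(ε^c)`. -/
def CNearEquivalentAt {k : ℕ} (c : ℝ) (A B : Set (EuclideanSpace ℝ (Fin k)))
    (θ : EuclideanSpace ℝ (Fin k)) : Prop :=
  θ ∈ A ∩ B ∧
  (fun ε : ℝ => Metric.hausdorffDist (A ∩ Metric.ball θ ε) (B ∩ Metric.ball θ ε))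
    =O[𝓝[>] 0] fun ε : ℝ => ε ^ c

/-- Near its point `θ`, the set `A` is a twice continuously differentiable embedded submanifold
of `ℝᵏ`: a level set of a `C²` map that is a submersion at `θ`. -/
def IsC2SubmanifoldAt {k : ℕ} (A : Set (EuclideanSpace ℝ (Fin k)))
    (θ : EuclideanSpace ℝ (Fin k)) : Prop :=
  θ ∈ A ∧
  ∃ (q : ℕ) (U : Set (EuclideanSpace ℝ (Fin k)))
    (g : EuclideanSpace ℝ (Fin k) → EuclideanSpace ℝ (Fin q)),
    IsOpen U ∧ θ ∈ U ∧ ContDiffOn ℝ 2 g U ∧ Function.Surjective (fderiv ℝ g θ) ∧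
      A ∩ U = {x ∈ U | g x = 0}

/-!
Let `R` be the root of the likelihood ratio of `P_{θ₁}` and `P_{θ₂}`. Under `P_{θ₂}` the product
`Rₙ = ∏ R(Xᵢ)` has mean `(1 - H² / 2)ⁿ` and second moment at most `1`, where `H` is the Hellinger
distance, so Bernoulli's inequality gives `E (Rₙ - 1)² ≤ n H²`. If `n H² → 0`, then `Rₙ → 1` in
mean square, which controls at once the power of every test and the log-likelihood difference
`2 log Rₙ`. Double differentiability in quadratic mean makes `H²` of order `‖h - h'‖²`, uniformly in
`h` and `h'`, so that moving a local alternative by `o(n^(-1/2))` goes unnoticed.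

A point `x` of one model lies within `o(‖x - θ‖ ^ c)` or `O(‖x - θ‖ ^ c)` of the other one if the
models are `c`-equivalent or `c`-near-equivalent, and this is `o(n^(-1/2))` for the deviations
considered. For `C²` submanifolds, `1`-equivalence forces equal tangent spaces; the two models then
agree to first order, and Taylor's formula leaves a gap of order `‖x - θ‖²`.
-/

/-- `ρ` is a square root of the likelihood ratio `dP/dQ`. Only the part of `P` that is absolutely
continuous with respect to `Q` can be reached by a density, so `ρ²` is merely required to be the
density of a measure below `P`. -/
structure IsRootLikelihoodRatio {Ω : Type*} [MeasurableSpace Ω] (ρ : Ω → ℝ) (P Q : Measure Ω) :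
    Prop where
  measurable : Measurable ρ
  nonneg : ∀ x, 0 ≤ ρ x
  withDensity_sq_le : (Q.withDensity fun x => ENNReal.ofReal (ρ x ^ 2)) ≤ P

theorem sq_integral_abs_le_integral_sq {Ω : Type*} [MeasurableSpace Ω] {P : Measure Ω}
    [IsProbabilityMeasure P] {f : Ω → ℝ} (hf : MemLp f 2 P) :
    (∫ x, |f x| ∂P) ^ 2 ≤ ∫ x, f x ^ 2 ∂P := by
  have h := ProbabilityTheory.variance_eq_sub hf.abs
  simp only [Pi.pow_apply, Pi.abs_apply, sq_abs] at h
  linarith [ProbabilityTheory.variance_nonneg |f| P]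

namespace IsRootLikelihoodRatio

variable {Ω : Type*} [MeasurableSpace Ω] {P Q : Measure Ω} {ρ : Ω → ℝ}

theorem lintegral_ofReal_sq_le (h : IsRootLikelihoodRatio ρ P Q) :
    ∫⁻ x, ENNReal.ofReal (ρ x ^ 2) ∂Q ≤ P Set.univ := by
  rw [← setLIntegral_univ, ← withDensity_apply _ MeasurableSet.univ]
  exact h.withDensity_sq_le Set.univ

theorem integrable_sq [IsFiniteMeasure P] (h : IsRootLikelihoodRatio ρ P Q) :
    Integrable (fun x => ρ x ^ 2) Q :=
  ⟨(h.measurable.pow_const 2).aestronglyMeasurable,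
    (hasFiniteIntegral_iff_ofReal (ae_of_all _ fun x => sq_nonneg (ρ x))).2
      (h.lintegral_ofReal_sq_le.trans_lt (measure_lt_top P _))⟩

theorem memLp_two [IsFiniteMeasure P] (h : IsRootLikelihoodRatio ρ P Q) : MemLp ρ 2 Q :=
  (memLp_two_iff_integrable_sq h.measurable.aestronglyMeasurable).2 h.integrable_sq

theorem integral_sq_mul_le (h : IsRootLikelihoodRatio ρ P Q) {φ : Ω → ℝ} (hφ : ∀ x, 0 ≤ φ x)
    (hφP : Integrable φ P) : ∫ x, ρ x ^ 2 * φ x ∂Q ≤ ∫ x, φ x ∂P := by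
  refine le_of_eq_of_le ?_ (integral_mono_measure h.withDensity_sq_le (ae_of_all _ hφ) hφP)
  rw [integral_withDensity_eq_integral_toReal_smul (h.measurable.pow_const 2).ennreal_ofReal
    (ae_of_all _ fun _ => ENNReal.ofReal_lt_top)]
  simp only [ENNReal.toReal_ofReal (sq_nonneg _), smul_eq_mul]

theorem integral_sq_le_one [IsProbabilityMeasure P] (h : IsRootLikelihoodRatio ρ P Q) :
    ∫ x, ρ x ^ 2 ∂Q ≤ 1 := by
  simpa using h.integral_sq_mul_le (fun _ => zero_le_one) (integrable_const (1 : ℝ))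

theorem memLp_sub_one [IsFiniteMeasure P] [IsFiniteMeasure Q]
    (h : IsRootLikelihoodRatio ρ P Q) : MemLp (fun x => ρ x - 1) 2 Q :=
  h.memLp_two.sub (memLp_const 1)

theorem measure_le_abs_sub_one_le [IsFiniteMeasure P] [IsFiniteMeasure Q]
    (h : IsRootLikelihoodRatio ρ P Q) {η : ℝ} (hη : 0 < η) :
    Q {x | η ≤ |ρ x - 1|} ≤ ENNReal.ofReal ((∫ x, (ρ x - 1) ^ 2 ∂Q) / η ^ 2) := by
  have hset : {x | η ≤ |ρ x - 1|} = {x | η ^ 2 ≤ (ρ x - 1) ^ 2} := by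
    ext x
    rw [Set.mem_ofPred_eq, Set.mem_ofPred_eq, ← sq_abs (ρ x - 1),
      pow_le_pow_iff_left₀ hη.le (abs_nonneg _) two_ne_zero]
  rw [hset, ← ofReal_measureReal]
  refine ENNReal.ofReal_le_ofReal ((le_div_iff₀' (pow_pos hη 2)).2 ?_)
  exact mul_meas_ge_le_integral_of_nonneg (ae_of_all _ fun x => sq_nonneg (ρ x - 1))
    h.memLp_sub_one.integrable_sq _

variable [IsProbabilityMeasure P] [IsProbabilityMeasure Q]

theorem integral_sub_one_sq_le (h : IsRootLikelihoodRatio ρ P Q) :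
    ∫ x, (ρ x - 1) ^ 2 ∂Q ≤ 2 * (1 - ∫ x, ρ x ∂Q) := by
  have hρ : Integrable ρ Q := h.memLp_two.integrable one_le_two
  have hdiff : Integrable (fun x => ρ x ^ 2 - 2 * ρ x) Q := h.integrable_sq.sub (hρ.const_mul 2)
  have hexpand : ∫ x, (ρ x - 1) ^ 2 ∂Q = ∫ x, ρ x ^ 2 ∂Q - 2 * ∫ x, ρ x ∂Q + 1 := by
    simp only [sub_sq, mul_one, one_pow]
    rw [integral_add hdiff (integrable_const 1), integral_sub h.integrable_sq (hρ.const_mul 2),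
      integral_const_mul, integral_const, probReal_univ, one_smul]
  linarith [h.integral_sq_le_one]

theorem integral_sub_integral_le (h : IsRootLikelihoodRatio ρ P Q) {φ : Ω → ℝ}
    (hφ : Measurable φ) (hφ₁ : ∀ x, φ x ∈ Set.Icc (0 : ℝ) 1) :
    ∫ x, φ x ∂Q - ∫ x, φ x ∂P ≤ 2 * ∫ x, |ρ x - 1| ∂Q := by
  have hφQ : Integrable φ Q := .of_mem_Icc 0 1 hφ.aemeasurable (ae_of_all _ hφ₁)
  have hφP : Integrable φ P := .of_mem_Icc 0 1 hφ.aemeasurable (ae_of_all _ hφ₁)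
  have hsq : Integrable (fun x => ρ x ^ 2 * φ x) Q :=
    h.integrable_sq.mul_bdd (c := 1) hφ.aestronglyMeasurable (ae_of_all _ fun x =>
      (Real.norm_of_nonneg (hφ₁ x).1).trans_le (hφ₁ x).2)
  have hpoint : ∀ x, φ x - ρ x ^ 2 * φ x ≤ 2 * |ρ x - 1| := fun x => by
    have hle : 1 - ρ x ^ 2 ≤ 2 * |ρ x - 1| := by
      nlinarith [neg_abs_le (ρ x - 1), sq_nonneg (ρ x - 1)]
    calc φ x - ρ x ^ 2 * φ x = (1 - ρ x ^ 2) * φ x := by ring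
      _ ≤ 2 * |ρ x - 1| * φ x := mul_le_mul_of_nonneg_right hle (hφ₁ x).1
      _ ≤ 2 * |ρ x - 1| := mul_le_of_le_one_right (by positivity) (hφ₁ x).2
  calc ∫ x, φ x ∂Q - ∫ x, φ x ∂P ≤ ∫ x, φ x ∂Q - ∫ x, ρ x ^ 2 * φ x ∂Q :=
        sub_le_sub_left (h.integral_sq_mul_le (fun x => (hφ₁ x).1) hφP) _
    _ = ∫ x, (φ x - ρ x ^ 2 * φ x) ∂Q := (integral_sub hφQ hsq).symm
    _ ≤ ∫ x, 2 * |ρ x - 1| ∂Q :=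
        integral_mono (hφQ.sub hsq)
          ((h.memLp_sub_one.integrable one_le_two).abs.const_mul 2) hpoint
    _ = 2 * ∫ x, |ρ x - 1| ∂Q := integral_const_mul _ _

theorem abs_integral_sub_integral_le (h : IsRootLikelihoodRatio ρ P Q) {φ : Ω → ℝ}
    (hφ : Measurable φ) (hφ₁ : ∀ x, φ x ∈ Set.Icc (0 : ℝ) 1) :
    |∫ x, φ x ∂P - ∫ x, φ x ∂Q| ≤ 2 * √(∫ x, (ρ x - 1) ^ 2 ∂Q) := by
  have integral_one_sub : ∀ (ν : Measure Ω) [IsProbabilityMeasure ν],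
      ∫ x, (1 - φ x) ∂ν = 1 - ∫ x, φ x ∂ν := fun ν _ => by
    rw [integral_sub (integrable_const 1)
      (.of_mem_Icc 0 1 hφ.aemeasurable (ae_of_all _ hφ₁)), integral_const, probReal_univ, one_smul]
  have hroot : ∫ x, |ρ x - 1| ∂Q ≤ √(∫ x, (ρ x - 1) ^ 2 ∂Q) :=
    Real.le_sqrt_of_sq_le (sq_integral_abs_le_integral_sq h.memLp_sub_one)
  have hle := h.integral_sub_integral_le hφ hφ₁
  have hge := h.integral_sub_integral_le (φ := fun x => 1 - φ x) (hφ.const_sub 1)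
    fun x => ⟨sub_nonneg.2 (hφ₁ x).2, sub_le_self _ (hφ₁ x).1⟩
  rw [integral_one_sub P, integral_one_sub Q] at hge
  rw [abs_le]
  constructor <;> linarith

end IsRootLikelihoodRatio

namespace IsRootLikelihoodRatio

variable {Ω : ℕ → Type*} [∀ n, MeasurableSpace (Ω n)] {P Q : ∀ n, Measure (Ω n)}
  [∀ n, IsProbabilityMeasure (P n)] [∀ n, IsProbabilityMeasure (Q n)] {ρ : ∀ n, Ω n → ℝ}

theorem tendsto_integral_sub_integral (h : ∀ n, IsRootLikelihoodRatio (ρ n) (P n) (Q n))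
    (hρ : Tendsto (fun n => ∫ x, (ρ n x - 1) ^ 2 ∂Q n) atTop (𝓝 0)) {φ : ∀ n, Ω n → ℝ}
    (hφ : ∀ n, Measurable (φ n)) (hφ₁ : ∀ n x, φ n x ∈ Set.Icc (0 : ℝ) 1) :
    Tendsto (fun n => ∫ x, φ n x ∂P n - ∫ x, φ n x ∂Q n) atTop (𝓝 0) :=
  squeeze_zero_norm (fun n => (h n).abs_integral_sub_integral_le (hφ n) (hφ₁ n))
    (by simpa using hρ.sqrt.const_mul 2)

theorem tendsto_measure_abs_sub_one_lt (h : ∀ n, IsRootLikelihoodRatio (ρ n) (P n) (Q n))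
    (hρ : Tendsto (fun n => ∫ x, (ρ n x - 1) ^ 2 ∂Q n) atTop (𝓝 0)) {η : ℝ} (hη : 0 < η) :
    Tendsto (fun n => Q n {x | |ρ n x - 1| < η}) atTop (𝓝 1) := by
  have hbad : Tendsto (fun n => Q n {x | η ≤ |ρ n x - 1|}) atTop (𝓝 0) :=
    tendsto_of_tendsto_of_tendsto_of_le_of_le tendsto_const_nhds
      (by simpa using ENNReal.tendsto_ofReal (hρ.div_const (η ^ 2))) (fun _ => zero_le)
      fun n => (h n).measure_le_abs_sub_one_le hη
  have hcompl : ∀ n, Q n {x | |ρ n x - 1| < η} = 1 - Q n {x | η ≤ |ρ n x - 1|} := fun n => by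
    rw [← prob_compl_eq_one_sub
      (measurableSet_le measurable_const ((h n).measurable.sub_const 1).abs)]
    congr 1
    ext x
    simp
  simpa [hcompl] using ENNReal.Tendsto.sub tendsto_const_nhds hbad (.inl ENNReal.one_ne_top)

end IsRootLikelihoodRatio

section Pi

variable {ι : Type*} [Fintype ι] {Ω : ι → Type*} [∀ i, MeasurableSpace (Ω i)]

theorem measure_pi_mono {P Q : ∀ i, Measure (Ω i)} (h : ∀ i, P i ≤ Q i) :
    Measure.pi P ≤ Measure.pi Q := by
  refine Measure.le_iff.2 fun s hs => ?_
  simp only [Measure.pi, toMeasure_apply _ _ hs]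
  refine OuterMeasure.le_pi.2 (fun t _ => ?_) s
  exact (OuterMeasure.pi_pi_le _ t).trans (Finset.prod_le_prod' fun i _ => h i (t i))

theorem prod_indicator_eq_indicator_pi {α : ι → Type*} {M : Type*} [CommMonoidWithZero M]
    (s : ∀ i, Set (α i)) (f : ∀ i, α i → M) (x : ∀ i, α i) :
    ∏ i, (s i).indicator (f i) (x i) =
      (Set.univ.pi s).indicator (fun y => ∏ i, f i (y i)) x := by
  by_cases hx : x ∈ Set.univ.pi s
  · rw [Set.indicator_of_mem hx]
    exact Finset.prod_congr rfl fun i _ => Set.indicator_of_mem (hx i (Set.mem_univ i)) _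
  · rw [Set.indicator_of_notMem hx]
    simp only [Set.mem_univ_pi, not_forall] at hx
    obtain ⟨i, hi⟩ := hx
    exact Finset.prod_eq_zero (Finset.mem_univ i) (Set.indicator_of_notMem hi _)

theorem lintegral_pi_prod_eq_prod_lintegral {Q : ∀ i, Measure (Ω i)}
    [∀ i, IsProbabilityMeasure (Q i)] {f : ∀ i, Ω i → ENNReal} (hf : ∀ i, Measurable (f i)) :
    ∫⁻ x, ∏ i, f i (x i) ∂(Measure.pi Q) = ∏ i, ∫⁻ y, f i y ∂(Q i) := by
  rw [ProbabilityTheory.lintegral_prod_eq_prod_lintegral_of_indepFun Finset.univ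
    (fun i (x : ∀ i, Ω i) => f i (x i))
    (ProbabilityTheory.iIndepFun_pi fun i => (hf i).aemeasurable)
    fun i => (hf i).comp (measurable_pi_apply i)]
  exact Finset.prod_congr rfl fun i _ => (measurePreserving_eval Q i).lintegral_comp (hf i)

theorem measure_pi_withDensity {Q : ∀ i, Measure (Ω i)} [∀ i, IsProbabilityMeasure (Q i)]
    {f : ∀ i, Ω i → ENNReal} (hf : ∀ i, Measurable (f i))
    [∀ i, SigmaFinite ((Q i).withDensity (f i))] :
    (Measure.pi fun i => (Q i).withDensity (f i)) =
      (Measure.pi Q).withDensity fun x => ∏ i, f i (x i) := by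
  refine Measure.pi_eq fun s hs => ?_
  calc (Measure.pi Q).withDensity (fun x => ∏ i, f i (x i)) (Set.univ.pi s)
      = ∫⁻ x, ∏ i, (s i).indicator (f i) (x i) ∂(Measure.pi Q) := by
        simp only [prod_indicator_eq_indicator_pi]
        rw [withDensity_apply _ (.univ_pi hs), lintegral_indicator (.univ_pi hs)]
    _ = ∏ i, ∫⁻ y, (s i).indicator (f i) y ∂(Q i) :=
        lintegral_pi_prod_eq_prod_lintegral fun i => (hf i).indicator (hs i)
    _ = ∏ i, (Q i).withDensity (f i) (s i) :=
        Finset.prod_congr rfl fun i _ => by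
          rw [lintegral_indicator (hs i), withDensity_apply _ (hs i)]

end Pi

namespace IsRootLikelihoodRatio

protected theorem pi {ι : Type*} [Fintype ι] {Ω : ι → Type*} [∀ i, MeasurableSpace (Ω i)]
    {ρ : ∀ i, Ω i → ℝ} {P Q : ∀ i, Measure (Ω i)} [∀ i, IsFiniteMeasure (P i)]
    [∀ i, IsProbabilityMeasure (Q i)] (h : ∀ i, IsRootLikelihoodRatio (ρ i) (P i) (Q i)) :
    IsRootLikelihoodRatio (fun x => ∏ i, ρ i (x i)) (Measure.pi P) (Measure.pi Q) where
  measurable := Finset.measurable_fun_prod _ fun i _ =>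
    (h i).measurable.comp (measurable_pi_apply i)
  nonneg x := Finset.prod_nonneg fun i _ => (h i).nonneg (x i)
  withDensity_sq_le := by
    have : ∀ i, IsFiniteMeasure ((Q i).withDensity fun y => ENNReal.ofReal (ρ i y ^ 2)) :=
      fun i => isFiniteMeasure_of_le _ (h i).withDensity_sq_le
    simp only [← Finset.prod_pow, ENNReal.ofReal_prod_of_nonneg fun _ _ => sq_nonneg _]
    rw [← measure_pi_withDensity fun i => ((h i).measurable.pow_const 2).ennreal_ofReal]
    exact measure_pi_mono fun i => (h i).withDensity_sq_le

theorem integral_pi_sub_one_sq_le {ι Ω : Type*} [Fintype ι] [MeasurableSpace Ω] {P Q : Measure Ω}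
    {ρ : Ω → ℝ} [IsProbabilityMeasure P] [IsProbabilityMeasure Q]
    (h : IsRootLikelihoodRatio ρ P Q) :
    ∫ x : ι → Ω, (∏ i, ρ (x i) - 1) ^ 2 ∂(Measure.pi fun _ => Q) ≤
      Fintype.card ι * (2 * (1 - ∫ x, ρ x ∂Q)) := by
  have hnonneg : 0 ≤ ∫ x, ρ x ∂Q := integral_nonneg h.nonneg
  have bernoulli := one_add_mul_le_pow (a := ∫ x, ρ x ∂Q - 1) (by linarith) (Fintype.card ι)
  have hpi := (IsRootLikelihoodRatio.pi fun _ : ι => h).integral_sub_one_sq_le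
  rw [integral_fintype_prod_eq_pow] at hpi
  rw [add_sub_cancel] at bernoulli
  linarith

end IsRootLikelihoodRatio

theorem eventually_ne_zero_and_abs_two_mul_log_lt {δ : ℝ} (hδ : 0 < δ) :
    ∀ᶠ t : ℝ in 𝓝 1, t ≠ 0 ∧ |2 * Real.log t| < δ := by
  have hcont : ContinuousAt (fun t => |2 * Real.log t|) 1 :=
    ((Real.continuousAt_log one_ne_zero).const_mul 2).abs
  exact (eventually_ne_nhds one_ne_zero).and (hcont.eventually_lt_const (by simpa using hδ))

namespace DominatedModel

variable {k : ℕ} {X : Type*} [MeasurableSpace X] (m : DominatedModel k X)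
  {θ θ₁ θ₂ : EuclideanSpace ℝ (Fin k)}

/-- The squared Hellinger distance of `P_{θ₁}` and `P_{θ₂}`, in the normalization without the
factor `1/2`. -/
noncomputable def hellingerSq (θ₁ θ₂ : EuclideanSpace ℝ (Fin k)) : ℝ :=
  ∫ x, (√(m.density θ₁ x) - √(m.density θ₂ x)) ^ 2 ∂m.μ

/-- The square root of the likelihood ratio of one observation, with the junk value `0` where
`p_{θ₂} = 0`. -/
noncomputable def rootRatio (θ₁ θ₂ : EuclideanSpace ℝ (Fin k)) (x : X) : ℝ :=
  √(m.density θ₁ x) / √(m.density θ₂ x)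

theorem isProbabilityMeasure_law (hθ : θ ∈ m.Θ) : IsProbabilityMeasure (m.law θ) :=
  ⟨by rw [law, withDensity_apply _ .univ, setLIntegral_univ, m.lintegral_density θ hθ]⟩

theorem integrable_density (hθ : θ ∈ m.Θ) : Integrable (m.density θ) m.μ :=
  ⟨(m.measurable_density θ hθ).aestronglyMeasurable,
    (hasFiniteIntegral_iff_ofReal (ae_of_all _ (m.density_nonneg θ hθ))).2 <|
      (m.lintegral_density θ hθ).trans_lt ENNReal.one_lt_top⟩

theorem integral_density (hθ : θ ∈ m.Θ) : ∫ x, m.density θ x ∂m.μ = 1 := by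
  rw [integral_eq_lintegral_of_nonneg_ae (ae_of_all _ (m.density_nonneg θ hθ))
    (m.measurable_density θ hθ).aestronglyMeasurable, m.lintegral_density θ hθ, ENNReal.toReal_one]

theorem memLp_sqrt_density (hθ : θ ∈ m.Θ) : MemLp (fun x => √(m.density θ x)) 2 m.μ := by
  rw [memLp_two_iff_integrable_sq (m.measurable_density θ hθ).sqrt.aestronglyMeasurable]
  simpa only [Real.sq_sqrt (m.density_nonneg θ hθ _)] using m.integrable_density hθ

theorem integral_law (hθ : θ ∈ m.Θ) (f : X → ℝ) :
    ∫ x, f x ∂m.law θ = ∫ x, m.density θ x * f x ∂m.μ := by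
  rw [law, integral_withDensity_eq_integral_toReal_smul
    (m.measurable_density θ hθ).ennreal_ofReal (ae_of_all _ fun _ => ENNReal.ofReal_lt_top)]
  simp only [ENNReal.toReal_ofReal (m.density_nonneg θ hθ _), smul_eq_mul]

theorem ae_density_pos (hθ : θ ∈ m.Θ) : ∀ᵐ x ∂m.law θ, 0 < m.density θ x := by
  rw [law, ae_withDensity_iff (m.measurable_density θ hθ).ennreal_ofReal]
  exact ae_of_all _ fun x hx => ENNReal.ofReal_pos.1 (pos_iff_ne_zero.2 hx)

theorem ae_forall_density_pos (hθ : θ ∈ m.Θ) (n : ℕ) :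
    ∀ᵐ x ∂m.sampleLaw n θ, ∀ i, 0 < m.density θ (x i) := by
  have := m.isProbabilityMeasure_law hθ
  exact ae_all_iff.2 fun i =>
    (measurePreserving_eval (fun _ : Fin n => m.law θ) i).quasiMeasurePreserving.ae
      (m.ae_density_pos hθ)

theorem hellingerSq_nonneg (θ₁ θ₂ : EuclideanSpace ℝ (Fin k)) : 0 ≤ m.hellingerSq θ₁ θ₂ :=
  integral_nonneg fun _ => sq_nonneg _

theorem integrable_sqrt_density_mul (hθ₁ : θ₁ ∈ m.Θ) (hθ₂ : θ₂ ∈ m.Θ) :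
    Integrable (fun x => √(m.density θ₁ x) * √(m.density θ₂ x)) m.μ :=
  (m.memLp_sqrt_density hθ₁).integrable_mul (m.memLp_sqrt_density hθ₂)

theorem integrable_sq_sqrt_density_sub (hθ₁ : θ₁ ∈ m.Θ) (hθ₂ : θ₂ ∈ m.Θ) :
    Integrable (fun x => (√(m.density θ₁ x) - √(m.density θ₂ x)) ^ 2) m.μ :=
  ((m.memLp_sqrt_density hθ₁).sub (m.memLp_sqrt_density hθ₂)).integrable_sq

theorem hellingerSq_eq (hθ₁ : θ₁ ∈ m.Θ) (hθ₂ : θ₂ ∈ m.Θ) :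
    m.hellingerSq θ₁ θ₂ =
      2 * (1 - ∫ x, √(m.density θ₁ x) * √(m.density θ₂ x) ∂m.μ) := by
  have hpoint : ∀ x, (√(m.density θ₁ x) - √(m.density θ₂ x)) ^ 2 =
      (m.density θ₁ x + m.density θ₂ x) - 2 * (√(m.density θ₁ x) * √(m.density θ₂ x)) :=
    fun x => by
      rw [sub_sq, Real.sq_sqrt (m.density_nonneg θ₁ hθ₁ x),
        Real.sq_sqrt (m.density_nonneg θ₂ hθ₂ x)]
      ring
  have hsum : Integrable (fun x => m.density θ₁ x + m.density θ₂ x) m.μ :=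
    (m.integrable_density hθ₁).add (m.integrable_density hθ₂)
  simp only [hellingerSq, hpoint]
  rw [integral_sub hsum ((m.integrable_sqrt_density_mul hθ₁ hθ₂).const_mul 2), integral_const_mul,
    integral_add (m.integrable_density hθ₁) (m.integrable_density hθ₂), m.integral_density hθ₁,
    m.integral_density hθ₂]
  ring

theorem hellingerSq_le_two (hθ₁ : θ₁ ∈ m.Θ) (hθ₂ : θ₂ ∈ m.Θ) : m.hellingerSq θ₁ θ₂ ≤ 2 := by
  have hnonneg : 0 ≤ ∫ x, √(m.density θ₁ x) * √(m.density θ₂ x) ∂m.μ :=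
    integral_nonneg fun x => by positivity
  linarith [m.hellingerSq_eq hθ₁ hθ₂]

theorem density_mul_rootRatio (hθ₂ : θ₂ ∈ m.Θ) (x : X) :
    m.density θ₂ x * m.rootRatio θ₁ θ₂ x = √(m.density θ₁ x) * √(m.density θ₂ x) := by
  nth_rewrite 1 [← Real.mul_self_sqrt (m.density_nonneg θ₂ hθ₂ x)]
  rw [rootRatio, mul_assoc]
  by_cases h : √(m.density θ₂ x) = 0
  · simp [h]
  · rw [mul_div_cancel₀ _ h, mul_comm]

theorem density_mul_rootRatio_sq_le (hθ₁ : θ₁ ∈ m.Θ) (hθ₂ : θ₂ ∈ m.Θ) (x : X) :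
    m.density θ₂ x * m.rootRatio θ₁ θ₂ x ^ 2 ≤ m.density θ₁ x := by
  rw [rootRatio, div_pow, Real.sq_sqrt (m.density_nonneg θ₁ hθ₁ x),
    Real.sq_sqrt (m.density_nonneg θ₂ hθ₂ x)]
  by_cases h : m.density θ₂ x = 0
  · simpa [h] using m.density_nonneg θ₁ hθ₁ x
  · rw [mul_div_cancel₀ _ h]

theorem isRootLikelihoodRatio_rootRatio (hθ₁ : θ₁ ∈ m.Θ) (hθ₂ : θ₂ ∈ m.Θ) :
    IsRootLikelihoodRatio (m.rootRatio θ₁ θ₂) (m.law θ₁) (m.law θ₂) where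
  measurable := (m.measurable_density θ₁ hθ₁).sqrt.div (m.measurable_density θ₂ hθ₂).sqrt
  nonneg x := by unfold rootRatio; positivity
  withDensity_sq_le := by
    have hmeas : Measurable fun x => ENNReal.ofReal (m.rootRatio θ₁ θ₂ x ^ 2) :=
      (((m.measurable_density θ₁ hθ₁).sqrt.div
        (m.measurable_density θ₂ hθ₂).sqrt).pow_const 2).ennreal_ofReal
    rw [law, law, ← withDensity_mul _ (m.measurable_density θ₂ hθ₂).ennreal_ofReal hmeas]
    refine withDensity_mono (ae_of_all _ fun x => ?_)
    rw [Pi.mul_apply, ← ENNReal.ofReal_mul (m.density_nonneg θ₂ hθ₂ x)]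
    exact ENNReal.ofReal_le_ofReal (m.density_mul_rootRatio_sq_le hθ₁ hθ₂ x)

theorem two_mul_one_sub_integral_rootRatio (hθ₁ : θ₁ ∈ m.Θ) (hθ₂ : θ₂ ∈ m.Θ) :
    2 * (1 - ∫ x, m.rootRatio θ₁ θ₂ x ∂m.law θ₂) = m.hellingerSq θ₁ θ₂ := by
  simp only [m.integral_law hθ₂, m.density_mul_rootRatio hθ₂, m.hellingerSq_eq hθ₁ hθ₂]

/-- The square root of the likelihood ratio of a sample of size `n`. -/
noncomputable def sampleRootRatio {n : ℕ} (θ₁ θ₂ : EuclideanSpace ℝ (Fin k)) (x : Fin n → X) : ℝ :=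
  ∏ i, m.rootRatio θ₁ θ₂ (x i)

theorem isProbabilityMeasure_sampleLaw (n : ℕ) (hθ : θ ∈ m.Θ) :
    IsProbabilityMeasure (m.sampleLaw n θ) := by
  have := m.isProbabilityMeasure_law hθ
  exact Measure.pi.instIsProbabilityMeasure _

theorem isRootLikelihoodRatio_sampleRootRatio (n : ℕ) (hθ₁ : θ₁ ∈ m.Θ) (hθ₂ : θ₂ ∈ m.Θ) :
    IsRootLikelihoodRatio (m.sampleRootRatio θ₁ θ₂) (m.sampleLaw n θ₁) (m.sampleLaw n θ₂) := by
  have := m.isProbabilityMeasure_law hθ₁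
  have := m.isProbabilityMeasure_law hθ₂
  exact .pi fun _ => m.isRootLikelihoodRatio_rootRatio hθ₁ hθ₂

theorem integral_sampleRootRatio_sub_one_sq_le (n : ℕ) (hθ₁ : θ₁ ∈ m.Θ) (hθ₂ : θ₂ ∈ m.Θ) :
    ∫ x, (m.sampleRootRatio θ₁ θ₂ x - 1) ^ 2 ∂m.sampleLaw n θ₂ ≤ n * m.hellingerSq θ₁ θ₂ := by
  have := m.isProbabilityMeasure_law hθ₁
  have := m.isProbabilityMeasure_law hθ₂
  rw [← m.two_mul_one_sub_integral_rootRatio hθ₁ hθ₂]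
  simpa only [Fintype.card_fin, sampleRootRatio, sampleLaw] using
    (m.isRootLikelihoodRatio_rootRatio hθ₁ hθ₂).integral_pi_sub_one_sq_le (ι := Fin n)

theorem two_mul_log_rootRatio {x : X} (h₁ : 0 < m.density θ₁ x) (h₂ : 0 < m.density θ₂ x) :
    2 * Real.log (m.rootRatio θ₁ θ₂ x) =
      Real.log (m.density θ₁ x) - Real.log (m.density θ₂ x) := by
  rw [rootRatio, Real.log_div (Real.sqrt_pos.2 h₁).ne' (Real.sqrt_pos.2 h₂).ne',
    Real.log_sqrt h₁.le, Real.log_sqrt h₂.le]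
  ring

theorem density_pos_of_rootRatio_ne_zero {x : X} (h : m.rootRatio θ₁ θ₂ x ≠ 0) :
    0 < m.density θ₁ x :=
  Real.sqrt_ne_zero'.1 (div_ne_zero_iff.1 h).1

theorem two_mul_log_sampleRootRatio {n : ℕ} {x : Fin n → X} (h₁ : ∀ i, 0 < m.density θ₁ (x i))
    (h₂ : ∀ i, 0 < m.density θ₂ (x i)) :
    2 * Real.log (m.sampleRootRatio θ₁ θ₂ x) = m.logLik θ₁ x - m.logLik θ₂ x := by
  have hne : ∀ i, m.rootRatio θ₁ θ₂ (x i) ≠ 0 := fun i =>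
    (div_pos (Real.sqrt_pos.2 (h₁ i)) (Real.sqrt_pos.2 (h₂ i))).ne'
  rw [sampleRootRatio, Real.log_prod fun i _ => hne i, Finset.mul_sum, logLik, logLik,
    ← Finset.sum_sub_distrib]
  exact Finset.sum_congr rfl fun i _ => m.two_mul_log_rootRatio (h₁ i) (h₂ i)

theorem asympIndistinguishable_of_tendsto_hellingerSq {θ₁ θ₂ : ℕ → EuclideanSpace ℝ (Fin k)}
    (hθ₁ : ∀ n, θ₁ n ∈ m.Θ) (hθ₂ : ∀ n, θ₂ n ∈ m.Θ)
    (hH : Tendsto (fun n : ℕ => n * m.hellingerSq (θ₁ n) (θ₂ n)) atTop (𝓝 0)) :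
    m.AsympIndistinguishable θ₁ θ₂ := by
  have := fun n => m.isProbabilityMeasure_sampleLaw n (hθ₁ n)
  have := fun n => m.isProbabilityMeasure_sampleLaw n (hθ₂ n)
  have hratio := fun n => m.isRootLikelihoodRatio_sampleRootRatio n (hθ₁ n) (hθ₂ n)
  have hL2 : Tendsto (fun n => ∫ x, (m.sampleRootRatio (θ₁ n) (θ₂ n) x - 1) ^ 2
      ∂m.sampleLaw n (θ₂ n)) atTop (𝓝 0) :=
    squeeze_zero (fun _ => integral_nonneg fun _ => sq_nonneg _)
      (fun n => m.integral_sampleRootRatio_sub_one_sq_le n (hθ₁ n) (hθ₂ n)) hH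
  refine ⟨fun φ hφ hφ₁ => IsRootLikelihoodRatio.tendsto_integral_sub_integral hratio hL2 hφ hφ₁,
    fun δ hδ => ?_⟩
  obtain ⟨η, hη, hlog⟩ := Metric.eventually_nhds_iff.1
    (eventually_ne_zero_and_abs_two_mul_log_lt hδ)
  refine tendsto_of_tendsto_of_tendsto_of_le_of_le
    (IsRootLikelihoodRatio.tendsto_measure_abs_sub_one_lt hratio hL2 hη) tendsto_const_nhds
    (fun n => measure_mono_ae ?_) fun n => prob_le_one
  filter_upwards [m.ae_forall_density_pos (hθ₂ n) n] with x hx₂ hx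
  obtain ⟨hne, hlt⟩ :=
    hlog (show dist (m.sampleRootRatio (θ₁ n) (θ₂ n) x) 1 < η from hx)
  have hx₁ : ∀ i, 0 < m.density (θ₁ n) (x i) := fun i =>
    m.density_pos_of_rootRatio_ne_zero (Finset.prod_ne_zero_iff.1 hne i (Finset.mem_univ i))
  exact ⟨fun i => ⟨hx₁ i, hx₂ i⟩, by rwa [← m.two_mul_log_sampleRootRatio hx₁ hx₂]⟩

end DominatedModel

theorem sq_le_two_mul_sq_sub_add {t : ℝ} (ht : t ≠ 0) (a b u : ℝ) :
    a ^ 2 ≤ 2 * (a - u) ^ 2 + 4 / t ^ 2 * (b ^ 2 + (b - t * u) ^ 2) := by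
  have hu : (t * u) ^ 2 ≤ 2 * (b ^ 2 + (b - t * u) ^ 2) := by
    linarith [sq_nonneg (2 * b - t * u)]
  calc a ^ 2 ≤ 2 * (a - u) ^ 2 + 2 * u ^ 2 := by linarith [sq_nonneg (a - 2 * u)]
    _ = 2 * (a - u) ^ 2 + 2 / t ^ 2 * (t * u) ^ 2 := by field_simp
    _ ≤ 2 * (a - u) ^ 2 + 2 / t ^ 2 * (2 * (b ^ 2 + (b - t * u) ^ 2)) := by gcongr
    _ = 2 * (a - u) ^ 2 + 4 / t ^ 2 * (b ^ 2 + (b - t * u) ^ 2) := by ring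

namespace DominatedModel

variable {k : ℕ} {X : Type*} [MeasurableSpace X] {m : DominatedModel k X}
  {θ : EuclideanSpace ℝ (Fin k)}

/- Subtracting the remainder at a far point `z` of the line through `h` and `h'` expresses the
score term by a bounded quantity, so that no integrability of the score is needed. -/
theorem hellingerSq_add_le_of_sub_eq_smul
    {s : EuclideanSpace ℝ (Fin k) → X → EuclideanSpace ℝ (Fin k)}
    {h h' z : EuclideanSpace ℝ (Fin k)} {t : ℝ} (ht : t ≠ 0) (hz : z - h' = t • (h - h'))
    (hΘ : θ + h ∈ m.Θ) (hΘ' : θ + h' ∈ m.Θ) (hΘz : θ + z ∈ m.Θ)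
    (hint : Integrable (m.ddqmRemainder s θ h h') m.μ)
    (hintz : Integrable (m.ddqmRemainder s θ z h') m.μ) :
    m.hellingerSq (θ + h) (θ + h') ≤ 2 * ∫ x, m.ddqmRemainder s θ h h' x ∂m.μ +
      4 / t ^ 2 * (m.hellingerSq (θ + z) (θ + h') + ∫ x, m.ddqmRemainder s θ z h' x ∂m.μ) := by
  have hpoint : ∀ x, (√(m.density (θ + h) x) - √(m.density (θ + h') x)) ^ 2 ≤
      2 * m.ddqmRemainder s θ h h' x + 4 / t ^ 2 *
        ((√(m.density (θ + z) x) - √(m.density (θ + h') x)) ^ 2 +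
          m.ddqmRemainder s θ z h' x) := fun x => by
    rw [ddqmRemainder, ddqmRemainder, hz, real_inner_smul_left, mul_left_comm (1 / 2) t,
      mul_assoc t]
    exact sq_le_two_mul_sq_sub_add ht _ _ _
  have hH := m.integrable_sq_sqrt_density_sub hΘ hΘ'
  have hHz := m.integrable_sq_sqrt_density_sub hΘz hΘ'
  have hsum : Integrable (fun x => (√(m.density (θ + z) x) - √(m.density (θ + h') x)) ^ 2 +
      m.ddqmRemainder s θ z h' x) m.μ := hHz.add hintz
  calc m.hellingerSq (θ + h) (θ + h')
      ≤ ∫ x, (2 * m.ddqmRemainder s θ h h' x + 4 / t ^ 2 *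
          ((√(m.density (θ + z) x) - √(m.density (θ + h') x)) ^ 2 +
            m.ddqmRemainder s θ z h' x)) ∂m.μ :=
        integral_mono hH ((hint.const_mul 2).add (hsum.const_mul _)) hpoint
    _ = _ := by
        rw [integral_add (hint.const_mul 2) (hsum.const_mul _), integral_const_mul,
          integral_const_mul, integral_add hHz hintz, hellingerSq]

theorem DDQMAt.eventually_integral_ddqmRemainder_le (hθ : m.DDQMAt θ) :
    ∃ s : EuclideanSpace ℝ (Fin k) → X → EuclideanSpace ℝ (Fin k),
      ∀ᶠ p : EuclideanSpace ℝ (Fin k) × EuclideanSpace ℝ (Fin k) in 𝓝 0,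
        Integrable (m.ddqmRemainder s θ p.1 p.2) m.μ ∧
          ∫ x, m.ddqmRemainder s θ p.1 p.2 x ∂m.μ ≤ ‖p.1 - p.2‖ ^ 2 := by
  obtain ⟨-, s, -, hs⟩ := hθ
  refine ⟨s, eventually_iff_seq_eventually.2 fun p hp => ?_⟩
  obtain ⟨hint, hrem⟩ := hs (fun n => (p n).1) (fun n => (p n).2)
    ((continuous_fst.tendsto' _ _ rfl).comp hp) ((continuous_snd.tendsto' _ _ rfl).comp hp)
  filter_upwards [hint, hrem.bound one_pos] with n hn₁ hn₂
  rw [one_mul, Real.norm_of_nonneg (sq_nonneg _)] at hn₂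
  exact ⟨hn₁, (Real.le_norm_self _).trans hn₂⟩

theorem DDQMAt.exists_radius_integral_ddqmRemainder_le (hθ : m.DDQMAt θ) :
    ∃ s : EuclideanSpace ℝ (Fin k) → X → EuclideanSpace ℝ (Fin k), ∃ r > 0,
      (∀ h, ‖h‖ < r → θ + h ∈ m.Θ) ∧ ∀ h h', ‖h‖ < r → ‖h'‖ < r →
        Integrable (m.ddqmRemainder s θ h h') m.μ ∧
          ∫ x, m.ddqmRemainder s θ h h' x ∂m.μ ≤ ‖h - h'‖ ^ 2 := by
  obtain ⟨s, hs⟩ := hθ.eventually_integral_ddqmRemainder_le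
  have hΘ : ∀ᶠ h in 𝓝 0, θ + h ∈ m.Θ :=
    (continuous_const_add θ).continuousAt.eventually_mem
      (m.isOpen_Θ.mem_nhds (by simpa using hθ.1))
  obtain ⟨δ, hδ, hsδ⟩ := Metric.eventually_nhds_iff.1 hs
  obtain ⟨ε, hε, hΘε⟩ := Metric.eventually_nhds_iff.1 hΘ
  simp only [dist_zero_right] at hsδ hΘε
  refine ⟨s, min δ ε, lt_min hδ hε, fun h hh => hΘε (hh.trans_le (min_le_right _ _)),
    fun h h' hh hh' => hsδ (y := (h, h')) (max_lt ?_ ?_)⟩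
  exacts [hh.trans_le (min_le_left _ _), hh'.trans_le (min_le_left _ _)]

theorem DDQMAt.isBigO_hellingerSq (hθ : m.DDQMAt θ) :
    (fun p : EuclideanSpace ℝ (Fin k) × EuclideanSpace ℝ (Fin k) =>
      m.hellingerSq (θ + p.1) (θ + p.2)) =O[𝓝 0] fun p => ‖p.1 - p.2‖ ^ 2 := by
  obtain ⟨s, r, hr, hrΘ, hrem⟩ := hθ.exists_radius_integral_ddqmRemainder_le
  refine IsBigO.of_bound (2 + 16 / r ^ 2 * (2 + r ^ 2 / 4)) ?_
  filter_upwards [Metric.ball_mem_nhds 0 (half_pos hr)] with p hp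
  obtain ⟨hp₁, hp₂⟩ := max_lt_iff.1 (mem_ball_zero_iff.1 hp)
  rw [Real.norm_of_nonneg (m.hellingerSq_nonneg _ _), Real.norm_of_nonneg (sq_nonneg _)]
  rcases eq_or_ne p.1 p.2 with heq | hne
  · simp [hellingerSq, heq]
  have hd : 0 < ‖p.1 - p.2‖ := norm_pos_iff.2 (sub_ne_zero.2 hne)
  set t := r / 2 / ‖p.1 - p.2‖
  set z := p.2 + t • (p.1 - p.2)
  have hzp : z - p.2 = t • (p.1 - p.2) := add_sub_cancel_left _ _
  have hzd : ‖z - p.2‖ = r / 2 := by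
    rw [hzp, norm_smul, Real.norm_of_nonneg (by positivity), div_mul_cancel₀ _ hd.ne']
  have hz : ‖z‖ < r := by
    linarith [norm_le_norm_add_norm_sub' z p.2]
  have hp₁r : ‖p.1‖ < r := hp₁.trans (half_lt_self hr)
  have hp₂r : ‖p.2‖ < r := hp₂.trans (half_lt_self hr)
  calc m.hellingerSq (θ + p.1) (θ + p.2)
      ≤ 2 * ‖p.1 - p.2‖ ^ 2 + 4 / t ^ 2 * (2 + ‖z - p.2‖ ^ 2) := by
        refine (hellingerSq_add_le_of_sub_eq_smul (by positivity) hzp (hrΘ _ hp₁r) (hrΘ _ hp₂r)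
          (hrΘ _ hz) (hrem _ _ hp₁r hp₂r).1 (hrem _ _ hz hp₂r).1).trans ?_
        gcongr
        · exact (hrem _ _ hp₁r hp₂r).2
        · exact m.hellingerSq_le_two (hrΘ _ hz) (hrΘ _ hp₂r)
        · exact (hrem _ _ hz hp₂r).2
    _ = (2 + 16 / r ^ 2 * (2 + r ^ 2 / 4)) * ‖p.1 - p.2‖ ^ 2 := by
        rw [hzd]
        simp only [t]
        field_simp
        ring

theorem DDQMAt.asympIndistinguishable (hθ : m.DDQMAt θ) {h h' : ℕ → EuclideanSpace ℝ (Fin k)}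
    (hh : Tendsto h atTop (𝓝 0)) (hh' : Tendsto h' atTop (𝓝 0)) (hΘ : ∀ n, θ + h n ∈ m.Θ)
    (hΘ' : ∀ n, θ + h' n ∈ m.Θ)
    (hsub : (fun n => h n - h' n) =o[atTop] fun n : ℕ => (n : ℝ) ^ (-(1 / 2 : ℝ))) :
    m.AsympIndistinguishable (fun n => θ + h n) (fun n => θ + h' n) := by
  refine m.asympIndistinguishable_of_tendsto_hellingerSq hΘ hΘ' ?_
  have hH : (fun n => m.hellingerSq (θ + h n) (θ + h' n)) =o[atTop]
      fun n : ℕ => ((n : ℝ) ^ (-(1 / 2 : ℝ))) ^ 2 :=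
    (hθ.isBigO_hellingerSq.comp_tendsto (hh.prodMk_nhds hh')).trans_isLittleO
      (hsub.norm_left.pow two_pos)
  have hrate : (fun n : ℕ => (n : ℝ) * ((n : ℝ) ^ (-(1 / 2 : ℝ))) ^ 2) =O[atTop]
      fun _ => (1 : ℝ) := by
    refine IsBigO.of_bound 1 (Eventually.of_forall fun n => ?_)
    rw [← Real.rpow_mul_natCast n.cast_nonneg, Nat.cast_ofNat, neg_mul,
      one_div_mul_cancel two_ne_zero, Real.rpow_neg_one, norm_one, mul_one,
      Real.norm_of_nonneg (by positivity)]
    exact mul_inv_le_one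
  exact (isLittleO_one_iff ℝ).1 (((isBigO_refl _ _).mul_isLittleO hH).trans_isBigO hrate)

end DominatedModel

section HausdorffDist

variable {E : Type*} [PseudoMetricSpace E] {A B : Set E} {θ : E}

/- The Hausdorff distance need not be attained, hence the slack `η`. -/
theorem exists_mem_dist_le_hausdorffDist_add (hA : θ ∈ A) (hB : θ ∈ B) {η : ℝ → ℝ}
    (hη₀ : 0 ≤ η 0) (hη : ∀ ε > 0, 0 < η ε) {x : E} (hx : x ∈ A) :
    ∃ y ∈ B, dist y θ ≤ 2 * dist x θ ∧
      dist x y ≤ Metric.hausdorffDist (A ∩ Metric.ball θ (2 * dist x θ))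
        (B ∩ Metric.ball θ (2 * dist x θ)) + η (dist x θ) := by
  rcases (dist_nonneg : 0 ≤ dist x θ).eq_or_lt with h0 | hpos
  · refine ⟨θ, hB, by simp [← h0], ?_⟩
    rw [← h0]
    exact add_nonneg Metric.hausdorffDist_nonneg hη₀
  have hself : θ ∈ Metric.ball θ (2 * dist x θ) := Metric.mem_ball_self (by positivity)
  have hfin := Metric.hausdorffEDist_ne_top_of_nonempty_of_bounded (s := A ∩ Metric.ball θ _)
    (t := B ∩ Metric.ball θ _) ⟨θ, hA, hself⟩ ⟨θ, hB, hself⟩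
    (Metric.isBounded_ball.subset Set.inter_subset_right)
    (Metric.isBounded_ball.subset Set.inter_subset_right)
  have hxball : x ∈ A ∩ Metric.ball θ (2 * dist x θ) :=
    ⟨hx, Metric.mem_ball.2 (lt_two_mul_self hpos)⟩
  obtain ⟨y, ⟨hyB, hyball⟩, hxy⟩ := Metric.exists_dist_lt_of_hausdorffDist_lt hxball
    (lt_add_of_pos_right _ (hη _ hpos)) hfin
  exact ⟨y, hyB, (Metric.mem_ball.1 hyball).le, hxy.le⟩

end HausdorffDist

section ApproximateProjection

variable {E : Type*} [NormedAddCommGroup E] {A B : Set E} {θ : E}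

theorem tendsto_two_mul_norm_sub_nhdsGE_zero (θ : E) :
    Tendsto (fun x => 2 * ‖x - θ‖) (𝓝 θ) (𝓝[≥] 0) :=
  tendsto_nhdsWithin_iff.2
    ⟨(by fun_prop : Continuous fun x => 2 * ‖x - θ‖).tendsto' _ _ (by simp),
      Eventually.of_forall fun _ => Set.mem_Ici.2 (by positivity)⟩

theorem isBigO_two_mul_norm_sub_rpow (θ : E) {c : ℝ} (hc : 0 ≤ c) :
    (fun x => (2 * ‖x - θ‖) ^ c) =O[𝓝 θ] fun x => ‖x - θ‖ ^ c :=
  ((isBigO_refl _ _).const_mul_left 2).rpow hc (Eventually.of_forall fun _ => norm_nonneg _)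

theorem isLittleO_norm_sub_rpow_add_one (θ : E) {c : ℝ} (hc : 0 < c) :
    (fun x => ‖x - θ‖ ^ (c + 1)) =o[𝓝 θ] fun x => ‖x - θ‖ ^ c := by
  have hsmall : (fun x => ‖x - θ‖) =o[𝓝 θ] fun _ => (1 : ℝ) :=
    (isLittleO_one_iff ℝ).2 (tendsto_norm_sub_self θ)
  refine ((isBigO_refl (fun x => ‖x - θ‖ ^ c) _).mul_isLittleO hsmall).congr (fun x => ?_)
    fun x => mul_one _
  rw [Real.rpow_add_one' (norm_nonneg _) (by positivity)]

theorem exists_map_isBigO_of_hausdorffDist (hA : θ ∈ A) (hB : θ ∈ B) {η : ℝ → ℝ}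
    (hη₀ : 0 ≤ η 0) (hη : ∀ ε > 0, 0 < η ε) :
    ∃ π : E → E, (∀ x, π x ∈ B) ∧ (fun x => π x - θ) =O[𝓝[A] θ] (fun x => x - θ) ∧
      (fun x => x - π x) =O[𝓝[A] θ] fun x =>
        Metric.hausdorffDist (A ∩ Metric.ball θ (2 * ‖x - θ‖)) (B ∩ Metric.ball θ (2 * ‖x - θ‖)) +
          η ‖x - θ‖ := by
  have hex : ∀ x, ∃ y ∈ B, x ∈ A → dist y θ ≤ 2 * dist x θ ∧
      dist x y ≤ Metric.hausdorffDist (A ∩ Metric.ball θ (2 * dist x θ))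
        (B ∩ Metric.ball θ (2 * dist x θ)) + η (dist x θ) := fun x => by
    by_cases hx : x ∈ A
    · obtain ⟨y, hy, hxy⟩ := exists_mem_dist_le_hausdorffDist_add hA hB hη₀ hη hx
      exact ⟨y, hy, fun _ => hxy⟩
    · exact ⟨θ, hB, fun h => absurd h hx⟩
  choose π hπB hπ using hex
  simp only [dist_eq_norm] at hπ
  refine ⟨π, hπB, IsBigO.of_bound 2 ?_, IsBigO.of_bound 1 ?_⟩ <;>
    filter_upwards [self_mem_nhdsWithin] with x hx
  · exact (hπ x hx).1
  · rw [one_mul]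
    exact (hπ x hx).2.trans (Real.le_norm_self _)

theorem tangentConeAt_subset_of_isLittleO {𝕜 : Type*} [NontriviallyNormedField 𝕜]
    [NormedSpace 𝕜 E] {π : E → E} (hπB : ∀ x, π x ∈ B)
    (hπ : (fun x => x - π x) =o[𝓝[A] θ] fun x => x - θ) :
    tangentConeAt 𝕜 A θ ⊆ tangentConeAt 𝕜 B θ := by
  intro y hy
  obtain ⟨α, l, _, c, d, hd, hdA, hcd⟩ := exists_fun_of_mem_tangentConeAt hy
  have hlim : Tendsto (fun n => θ + d n) l (𝓝[A] θ) :=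
    tendsto_nhdsWithin_iff.2 ⟨by simpa using hd.const_add θ, hdA⟩
  have hdiff : (fun n => θ + d n - π (θ + d n)) =o[l] d := by
    simpa only [Function.comp_def, add_sub_cancel_left] using hπ.comp_tendsto hlim
  have hscaled : Tendsto (fun n => c n • (θ + d n - π (θ + d n))) l (𝓝 0) :=
    (isLittleO_one_iff ℝ).1
      (((isBigO_refl c l).smul_isLittleO hdiff).trans_isBigO (hcd.isBigO_one ℝ))
  refine mem_tangentConeAt_of_seq l c (fun n => d n - (θ + d n - π (θ + d n))) ?_
    (Eventually.of_forall fun n => ?_) ?_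
  · simpa using hd.sub (hdiff.trans_tendsto hd)
  · rw [add_sub_assoc', sub_sub_cancel]
    exact hπB _
  · simpa only [smul_sub, sub_zero] using hcd.sub hscaled

end ApproximateProjection

section Equivalence

variable {k : ℕ} {c : ℝ} {A B : Set (EuclideanSpace ℝ (Fin k))} {θ : EuclideanSpace ℝ (Fin k)}

theorem CEquivalentAt.symm (h : CEquivalentAt c A B θ) : CEquivalentAt c B A θ :=
  ⟨h.1.symm, by simpa only [Metric.hausdorffDist_comm] using h.2⟩

theorem CNearEquivalentAt.symm (h : CNearEquivalentAt c A B θ) : CNearEquivalentAt c B A θ :=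
  ⟨h.1.symm, by simpa only [Metric.hausdorffDist_comm] using h.2⟩

theorem CEquivalentAt.isLittleO (h : CEquivalentAt c A B θ) :
    (fun ε : ℝ => Metric.hausdorffDist (A ∩ Metric.ball θ ε) (B ∩ Metric.ball θ ε))
      =o[𝓝[≥] 0] fun ε : ℝ => ε ^ c := by
  have hpos : ∀ᶠ ε : ℝ in 𝓝[>] 0, 0 < ε := self_mem_nhdsWithin
  rw [← Set.Ioi_insert, isLittleO_insert (by simp),
    isLittleO_iff_tendsto' (hpos.mono fun ε hε h0 => absurd h0 (Real.rpow_pos_of_pos hε c).ne')]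
  refine h.2.congr' (hpos.mono fun ε hε => ?_)
  rw [Real.rpow_neg hε.le]
  exact (div_eq_inv_mul _ _).symm

theorem CNearEquivalentAt.isBigO (h : CNearEquivalentAt c A B θ) :
    (fun ε : ℝ => Metric.hausdorffDist (A ∩ Metric.ball θ ε) (B ∩ Metric.ball θ ε))
      =O[𝓝[≥] 0] fun ε : ℝ => ε ^ c := by
  obtain ⟨C, hC, hbound⟩ := h.2.exists_nonneg
  rw [← Set.Ioi_insert]
  exact (hbound.insert (by simpa using by positivity)).isBigO

theorem CEquivalentAt.exists_map_isLittleO (hc : 0 < c) (h : CEquivalentAt c A B θ) :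
    ∃ π : EuclideanSpace ℝ (Fin k) → EuclideanSpace ℝ (Fin k), (∀ x, π x ∈ B) ∧
      (fun x => π x - θ) =O[𝓝[A] θ] (fun x => x - θ) ∧
      (fun x => x - π x) =o[𝓝[A] θ] fun x => ‖x - θ‖ ^ c := by
  obtain ⟨π, hπB, hπθ, hπ⟩ := exists_map_isBigO_of_hausdorffDist h.1.1 h.1.2
    (η := fun ε => ε ^ (c + 1)) (by positivity) fun ε hε => by positivity
  refine ⟨π, hπB, hπθ, hπ.trans_isLittleO (IsLittleO.mono (.add ?_ ?_) nhdsWithin_le_nhds)⟩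
  · exact (h.isLittleO.comp_tendsto (tendsto_two_mul_norm_sub_nhdsGE_zero θ)).trans_isBigO
      (isBigO_two_mul_norm_sub_rpow θ hc.le)
  · exact isLittleO_norm_sub_rpow_add_one θ hc

theorem CNearEquivalentAt.exists_map_isBigO (hc : 0 < c) (h : CNearEquivalentAt c A B θ) :
    ∃ π : EuclideanSpace ℝ (Fin k) → EuclideanSpace ℝ (Fin k), (∀ x, π x ∈ B) ∧
      (fun x => π x - θ) =O[𝓝[A] θ] (fun x => x - θ) ∧
      (fun x => x - π x) =O[𝓝[A] θ] fun x => ‖x - θ‖ ^ c := by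
  obtain ⟨π, hπB, hπθ, hπ⟩ := exists_map_isBigO_of_hausdorffDist h.1.1 h.1.2
    (η := fun ε => ε ^ (c + 1)) (by positivity) fun ε hε => by positivity
  refine ⟨π, hπB, hπθ, hπ.trans (IsBigO.mono (.add ?_ ?_) nhdsWithin_le_nhds)⟩
  · exact (h.isBigO.comp_tendsto (tendsto_two_mul_norm_sub_nhdsGE_zero θ)).trans
      (isBigO_two_mul_norm_sub_rpow θ hc.le)
  · exact (isLittleO_norm_sub_rpow_add_one θ hc).isBigO

theorem CEquivalentAt.tangentConeAt_subset (h : CEquivalentAt 1 A B θ) :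
    tangentConeAt ℝ A θ ⊆ tangentConeAt ℝ B θ := by
  obtain ⟨π, hπB, -, hπ⟩ := h.exists_map_isLittleO one_pos
  simp only [Real.rpow_one] at hπ
  exact tangentConeAt_subset_of_isLittleO hπB hπ.of_norm_right

end Equivalence

theorem isBigO_sub_sub_fderiv_of_contDiffAt {E F : Type*} [NormedAddCommGroup E]
    [NormedSpace ℝ E] [NormedAddCommGroup F] [NormedSpace ℝ F] {f : E → F} {a : E}
    (hf : ContDiffAt ℝ 2 f a) :
    (fun x => f x - f a - fderiv ℝ f a (x - a)) =O[𝓝 a] fun x => ‖x - a‖ ^ 2 := by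
  obtain ⟨K, t, ht, hK⟩ := (hf.fderiv_right (m := 1) (by norm_num)).exists_lipschitzOnWith
  have hdiff : ∀ᶠ x in 𝓝 a, DifferentiableAt ℝ f x :=
    (hf.eventually (by simp)).mono fun x hx => hx.differentiableAt (by norm_num)
  obtain ⟨ρ, hρ, hball⟩ := Metric.mem_nhds_iff.1 (inter_mem ht hdiff)
  refine IsBigO.of_bound K ?_
  filter_upwards [Metric.ball_mem_nhds a hρ] with x hx
  have hsub : Metric.closedBall a ‖x - a‖ ⊆ t ∩ {x | DifferentiableAt ℝ f x} :=
    (Metric.closedBall_subset_ball (by rwa [← dist_eq_norm])).trans hball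
  have ha : a ∈ Metric.closedBall a ‖x - a‖ := Metric.mem_closedBall_self (norm_nonneg _)
  have hfderiv : ∀ y ∈ Metric.closedBall a ‖x - a‖,
      ‖fderiv ℝ f y - fderiv ℝ f a‖ ≤ K * ‖x - a‖ := fun y hy =>
    (hK.norm_sub_le (hsub hy).1 (hsub ha).1).trans (by gcongr; rwa [← dist_eq_norm])
  calc ‖f x - f a - fderiv ℝ f a (x - a)‖
      ≤ K * ‖x - a‖ * ‖x - a‖ := (convex_closedBall _ _).norm_image_sub_le_of_norm_fderiv_le'
        (fun y hy => (hsub hy).2) hfderiv ha (by rw [Metric.mem_closedBall, dist_eq_norm])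
    _ = K * ‖‖x - a‖ ^ 2‖ := by
      rw [mul_assoc, ← sq, Real.norm_of_nonneg (sq_nonneg _)]

theorem exists_forall_norm_apply_le_of_ker_le {E F G : Type*} [NormedAddCommGroup E]
    [NormedSpace ℝ E] [CompleteSpace E] [NormedAddCommGroup F] [NormedSpace ℝ F] [CompleteSpace F]
    [NormedAddCommGroup G] [NormedSpace ℝ G] {S : E →L[ℝ] F} {T : E →L[ℝ] G}
    (hS : Function.Surjective S) (hker : S.ker ≤ T.ker) : ∃ C, ∀ v, ‖T v‖ ≤ C * ‖S v‖ := by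
  let N := S.nonlinearRightInverseOfSurjective (LinearMap.range_eq_top.2 hS)
  refine ⟨‖T‖ * N.nnnorm, fun v => ?_⟩
  have hv : T v = T (N (S v)) := by
    rw [← sub_eq_zero, ← map_sub]
    refine hker (LinearMap.mem_ker.2 ?_)
    simp [N.right_inv]
  calc ‖T v‖ ≤ ‖T‖ * ‖N (S v)‖ := hv ▸ T.le_opNorm _
    _ ≤ ‖T‖ * (N.nnnorm * ‖S v‖) := by gcongr; exact N.bound _
    _ = ‖T‖ * N.nnnorm * ‖S v‖ := (mul_assoc _ _ _).symm

/-- Near its point `θ`, the set `A` is the zero set of `g`, which is strictly differentiable at `θ`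
with surjective derivative `g'`. -/
structure IsDefiningMapAt {E F : Type*} [NormedAddCommGroup E] [NormedSpace ℝ E]
    [NormedAddCommGroup F] [NormedSpace ℝ F] (g : E → F) (g' : E →L[ℝ] F) (A : Set E) (θ : E) :
    Prop where
  mem : θ ∈ A
  hasStrictFDerivAt : HasStrictFDerivAt g g' θ
  surjective : Function.Surjective g'
  eventually_mem_iff : ∀ᶠ x in 𝓝 θ, x ∈ A ↔ g x = 0

namespace IsDefiningMapAt

variable {E F G : Type*} [NormedAddCommGroup E] [NormedSpace ℝ E] [NormedAddCommGroup F]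
  [NormedSpace ℝ F] [NormedAddCommGroup G] [NormedSpace ℝ G] {g : E → F} {g' : E →L[ℝ] F}
  {f : E → G} {f' : E →L[ℝ] G} {A B : Set E} {θ : E}

theorem apply_eq_zero (hg : IsDefiningMapAt g g' A θ) : g θ = 0 :=
  hg.eventually_mem_iff.self_of_nhds.1 hg.mem

theorem eventually_apply_eq_zero (hg : IsDefiningMapAt g g' A θ) : ∀ᶠ x in 𝓝[A] θ, g x = 0 := by
  filter_upwards [nhdsWithin_le_nhds hg.eventually_mem_iff, self_mem_nhdsWithin] with x hx hxA
  exact hx.1 hxA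

theorem tangentConeAt_subset_ker (hg : IsDefiningMapAt g g' A θ) :
    tangentConeAt ℝ A θ ⊆ g'.ker := by
  have hzero : HasFDerivWithinAt g (0 : E →L[ℝ] F) A θ :=
    (hasFDerivWithinAt_const 0 θ A).congr_of_eventuallyEq hg.eventually_apply_eq_zero
      hg.apply_eq_zero
  exact hg.hasStrictFDerivAt.hasFDerivAt.hasFDerivWithinAt.unique_on hzero

theorem exists_eventually_norm_sub_le [CompleteSpace E] [CompleteSpace F]
    (hg : IsDefiningMapAt g g' A θ) :
    ∃ K : ℝ, ∀ᶠ x in 𝓝 θ, ∃ y ∈ A, ‖x - y‖ ≤ K * ‖g x‖ := by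
  have hrange : g'.range = ⊤ := LinearMap.range_eq_top.2 hg.surjective
  let N := g'.nonlinearRightInverseOfSurjective hrange
  have hN : 0 < N.nnnorm := g'.nonlinearRightInverseOfSurjective_nnnorm_pos hrange
  obtain ⟨s, hs, happ⟩ := hg.hasStrictFDerivAt.approximates_deriv_on_nhds (c := N.nnnorm⁻¹ / 2)
    (Or.inr (half_pos (inv_pos.2 hN)))
  obtain ⟨ρ, hρ, hball⟩ := Metric.mem_nhds_iff.1 (inter_mem hs hg.eventually_mem_iff)
  have hradius : Tendsto (fun x => 2 * N.nnnorm * ‖g x‖) (𝓝 θ) (𝓝 0) := by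
    simpa [hg.apply_eq_zero] using
      (hg.hasStrictFDerivAt.continuousAt.norm.const_mul (2 * (N.nnnorm : ℝ))).tendsto
  refine ⟨2 * N.nnnorm, ?_⟩
  filter_upwards [Metric.ball_mem_nhds θ (half_pos hρ),
    hradius.eventually (gt_mem_nhds (half_pos hρ))] with x hx hgx
  have hsub : Metric.closedBall x (2 * N.nnnorm * ‖g x‖) ⊆ s ∩ {x | x ∈ A ↔ g x = 0} :=
    (Metric.closedBall_subset_ball' (by linarith [Metric.mem_ball.1 hx])).trans hball
  have hzero : (0 : F) ∈ Metric.closedBall (g x)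
      (((N.nnnorm : ℝ)⁻¹ - (N.nnnorm⁻¹ / 2 : NNReal)) * (2 * N.nnnorm * ‖g x‖)) := by
    have hN' : (N.nnnorm : ℝ) ≠ 0 := NNReal.coe_ne_zero.2 hN.ne'
    rw [Metric.mem_closedBall, dist_zero_left]
    push_cast
    field_simp
    linarith
  obtain ⟨y, hy, hgy⟩ := happ.surjOn_closedBall_of_nonlinearRightInverse N (by positivity)
    (hsub.trans Set.inter_subset_left) hzero
  exact ⟨y, (hsub hy).2.2 hgy, by rwa [← dist_eq_norm, dist_comm]⟩

theorem exists_map_isBigO [CompleteSpace E] [CompleteSpace F] (hg : IsDefiningMapAt g g' A θ) :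
    ∃ σ : E → E, (∀ x, σ x ∈ A) ∧ (fun x => x - σ x) =O[𝓝 θ] g := by
  obtain ⟨K, hK⟩ := hg.exists_eventually_norm_sub_le
  have hex : ∀ x, ∃ y ∈ A, (∃ z ∈ A, ‖x - z‖ ≤ K * ‖g x‖) → ‖x - y‖ ≤ K * ‖g x‖ := fun x => by
    by_cases hx : ∃ z ∈ A, ‖x - z‖ ≤ K * ‖g x‖
    · obtain ⟨z, hz, hxz⟩ := hx
      exact ⟨z, hz, fun _ => hxz⟩
    · exact ⟨θ, hg.mem, fun h => absurd h hx⟩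
  choose σ hσA hσ using hex
  exact ⟨σ, hσA, IsBigO.of_bound K (hK.mono hσ)⟩

theorem ker_subset_tangentConeAt [CompleteSpace E] [CompleteSpace F]
    (hg : IsDefiningMapAt g g' A θ) : (g'.ker : Set E) ⊆ tangentConeAt ℝ A θ := by
  intro v hv
  obtain ⟨σ, hσA, hσ⟩ := hg.exists_map_isBigO
  let L : Set E := {x | g' (x - θ) = 0}
  have hgL : g =o[𝓝[L] θ] fun x => x - θ := by
    refine (hg.hasStrictFDerivAt.hasFDerivAt.isLittleO.mono nhdsWithin_le_nhds).congr' ?_ .rfl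
    filter_upwards [self_mem_nhdsWithin] with x hx
    rw [hg.apply_eq_zero, sub_zero, show g' (x - θ) = 0 from hx, sub_zero]
  have hvL : v ∈ tangentConeAt ℝ L θ :=
    mem_tangentConeAt_of_add_smul_mem (l := 𝓝[≠] (0 : ℝ)) tendsto_id
      (Eventually.of_forall fun r => by simp_all [L])
  exact tangentConeAt_subset_of_isLittleO hσA
    ((hσ.mono nhdsWithin_le_nhds).trans_isLittleO hgL) hvL

theorem exists_map_isBigO_sq [CompleteSpace E] [CompleteSpace F] [CompleteSpace G]
    (hg : IsDefiningMapAt g (fderiv ℝ g θ) A θ) (hf : IsDefiningMapAt f (fderiv ℝ f θ) B θ)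
    (hg₂ : ContDiffAt ℝ 2 g θ) (hf₂ : ContDiffAt ℝ 2 f θ)
    (hAB : tangentConeAt ℝ A θ ⊆ tangentConeAt ℝ B θ) :
    ∃ π : E → E, (∀ x, π x ∈ B) ∧ (fun x => x - π x) =O[𝓝[A] θ] fun x => ‖x - θ‖ ^ 2 := by
  obtain ⟨π, hπB, hπ⟩ := hf.exists_map_isBigO
  have hker : (fderiv ℝ g θ).ker ≤ (fderiv ℝ f θ).ker :=
    hg.ker_subset_tangentConeAt.trans (hAB.trans hf.tangentConeAt_subset_ker)
  obtain ⟨C, hC⟩ := exists_forall_norm_apply_le_of_ker_le hg.surjective hker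
  have hg' : (fun x => fderiv ℝ g θ (x - θ)) =O[𝓝[A] θ] fun x => ‖x - θ‖ ^ 2 := by
    refine ((isBigO_sub_sub_fderiv_of_contDiffAt hg₂).mono
      nhdsWithin_le_nhds).neg_left.congr' ?_ .rfl
    filter_upwards [hg.eventually_apply_eq_zero] with x hx
    simp [hx, hg.apply_eq_zero]
  have hf' : (fun x => fderiv ℝ f θ (x - θ)) =O[𝓝[A] θ] fun x => ‖x - θ‖ ^ 2 :=
    (IsBigO.of_bound C (Eventually.of_forall fun x => hC (x - θ))).trans hg'
  have hfA : f =O[𝓝[A] θ] fun x => ‖x - θ‖ ^ 2 := by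
    refine (((isBigO_sub_sub_fderiv_of_contDiffAt hf₂).mono nhdsWithin_le_nhds).add
      hf').congr_left fun x => ?_
    rw [sub_add_cancel, hf.apply_eq_zero, sub_zero]
  exact ⟨π, hπB, (hπ.mono nhdsWithin_le_nhds).trans hfA⟩

end IsDefiningMapAt

theorem IsC2SubmanifoldAt.exists_isDefiningMapAt {k : ℕ} {A : Set (EuclideanSpace ℝ (Fin k))}
    {θ : EuclideanSpace ℝ (Fin k)} (hA : IsC2SubmanifoldAt A θ) :
    ∃ (q : ℕ) (g : EuclideanSpace ℝ (Fin k) → EuclideanSpace ℝ (Fin q)),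
      IsDefiningMapAt g (fderiv ℝ g θ) A θ ∧ ContDiffAt ℝ 2 g θ := by
  obtain ⟨hθA, q, U, g, hU, hθU, hg, hsurj, hAU⟩ := hA
  have hg₂ : ContDiffAt ℝ 2 g θ := hg.contDiffAt (hU.mem_nhds hθU)
  have hmem : ∀ x ∈ U, (x ∈ A ↔ g x = 0) := fun x hx => by
    simpa [hx] using Set.ext_iff.1 hAU x
  exact ⟨q, g, ⟨hθA, hg₂.hasStrictFDerivAt (by norm_num), hsurj,
    eventually_of_mem (hU.mem_nhds hθU) hmem⟩, hg₂⟩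

theorem CEquivalentAt.exists_map_isBigO_sq {k : ℕ} {A B : Set (EuclideanSpace ℝ (Fin k))}
    {θ : EuclideanSpace ℝ (Fin k)} (hAB : CEquivalentAt 1 A B θ) (hA : IsC2SubmanifoldAt A θ)
    (hB : IsC2SubmanifoldAt B θ) :
    ∃ π : EuclideanSpace ℝ (Fin k) → EuclideanSpace ℝ (Fin k), (∀ x, π x ∈ B) ∧
      (fun x => π x - θ) =O[𝓝[A] θ] (fun x => x - θ) ∧
      (fun x => x - π x) =O[𝓝[A] θ] fun x => ‖x - θ‖ ^ 2 := by
  obtain ⟨p, g, hg, hg₂⟩ := hA.exists_isDefiningMapAt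
  obtain ⟨q, f, hf, hf₂⟩ := hB.exists_isDefiningMapAt
  obtain ⟨π, hπB, hπ⟩ := hg.exists_map_isBigO_sq hf hg₂ hf₂ hAB.tangentConeAt_subset
  have hsq : (fun x => ‖x - θ‖ ^ 2) =O[𝓝[A] θ] fun x => x - θ :=
    (isLittleO_norm_pow_id one_lt_two).isBigO.comp_tendsto
      ((tendsto_sub_nhds_zero_iff.2 tendsto_id).mono_left nhdsWithin_le_nhds)
  exact ⟨π, hπB, ((isBigO_refl (fun x => x - θ) _).sub (hπ.trans hsq)).congr_left fun x => by abel,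
    hπ⟩

theorem tendsto_natCast_rpow_neg {a : ℝ} (ha : 0 < a) :
    Tendsto (fun n : ℕ => (n : ℝ) ^ (-a)) atTop (𝓝 0) :=
  (tendsto_rpow_neg_atTop ha).comp tendsto_natCast_atTop_atTop

theorem natCast_rpow_neg_one_div_two_mul_rpow {c : ℝ} (hc : c ≠ 0) (n : ℕ) :
    ((n : ℝ) ^ (-(1 / (2 * c)))) ^ c = (n : ℝ) ^ (-(1 / 2 : ℝ)) := by
  rw [← Real.rpow_mul n.cast_nonneg]
  congr 1
  field_simp

namespace DominatedModel

variable {k : ℕ} {X : Type*} [MeasurableSpace X] {m : DominatedModel k X}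
  {θ : EuclideanSpace ℝ (Fin k)} {A B : Set (EuclideanSpace ℝ (Fin k))} {c : ℝ}

theorem DDQMAt.locallyMimicked (hθ : m.DDQMAt θ) (hA : A ⊆ m.Θ) (hB : B ⊆ m.Θ)
    {π : EuclideanSpace ℝ (Fin k) → EuclideanSpace ℝ (Fin k)} (hπB : ∀ x, π x ∈ B)
    (hπθ : (fun x => π x - θ) =O[𝓝[A] θ] fun x => x - θ)
    {order : (ℕ → EuclideanSpace ℝ (Fin k)) → Prop}
    (hlim : ∀ h, order h → Tendsto h atTop (𝓝 0))
    (horder : ∀ h h', order h → h' =O[atTop] h → order h')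
    (hsub : ∀ h, order h → Tendsto (fun n => θ + h n) atTop (𝓝[A] θ) →
      (fun n => θ + h n - π (θ + h n)) =o[atTop] fun n : ℕ => (n : ℝ) ^ (-(1 / 2 : ℝ))) :
    m.LocallyMimicked A B θ order := by
  intro h hh hhA
  have hlimA : Tendsto (fun n => θ + h n) atTop (𝓝[A] θ) :=
    tendsto_nhdsWithin_iff.2 ⟨by simpa using (hlim h hh).const_add θ, Eventually.of_forall hhA⟩
  have hO : (fun n => π (θ + h n) - θ) =O[atTop] h := by
    simpa only [Function.comp_def, add_sub_cancel_left] using hπθ.comp_tendsto hlimA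
  have hh' := horder h _ hh hO
  refine ⟨fun n => π (θ + h n) - θ, hh', fun n => ?_,
    hθ.asympIndistinguishable (hlim h hh) (hlim _ hh') (fun n => hA (hhA n)) (fun n => hB ?_) ?_⟩
  · rw [add_sub_cancel]
    exact hπB _
  · rw [add_sub_cancel]
    exact hπB _
  · exact (hsub h hh hlimA).congr_left fun n => by abel

theorem DDQMAt.locallyMimicked_of_cEquivalentAt (hθ : m.DDQMAt θ) (hA : A ⊆ m.Θ) (hB : B ⊆ m.Θ)
    (hc : 0 < c) (hAB : CEquivalentAt c A B θ) :
    m.LocallyMimicked A B θ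
      (fun h => h =O[atTop] fun n : ℕ => (n : ℝ) ^ (-(1 / (2 * c)))) := by
  obtain ⟨π, hπB, hπθ, hπ⟩ := hAB.exists_map_isLittleO hc
  refine hθ.locallyMimicked hA hB hπB hπθ
    (fun h hh => hh.trans_tendsto (tendsto_natCast_rpow_neg (by positivity)))
    (fun h h' hh hh' => hh'.trans hh) fun h hh hlim => ?_
  have hrate : (fun n => ‖h n‖ ^ c) =O[atTop] fun n : ℕ => (n : ℝ) ^ (-(1 / 2 : ℝ)) :=
    (hh.norm_left.rpow hc.le (Eventually.of_forall fun n => by positivity)).congr_right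
      (natCast_rpow_neg_one_div_two_mul_rpow hc.ne')
  refine (hπ.comp_tendsto hlim).trans_isBigO (hrate.congr_left fun n => ?_)
  rw [Function.comp_apply, add_sub_cancel_left]

theorem DDQMAt.locallyMimicked_of_cNearEquivalentAt (hθ : m.DDQMAt θ) (hA : A ⊆ m.Θ)
    (hB : B ⊆ m.Θ) (hc : 0 < c) (hAB : CNearEquivalentAt c A B θ) :
    m.LocallyMimicked A B θ
      (fun h => h =o[atTop] fun n : ℕ => (n : ℝ) ^ (-(1 / (2 * c)))) := by
  obtain ⟨π, hπB, hπθ, hπ⟩ := hAB.exists_map_isBigO hc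
  refine hθ.locallyMimicked hA hB hπB hπθ
    (fun h hh => hh.trans_tendsto (tendsto_natCast_rpow_neg (by positivity)))
    (fun h h' hh hh' => hh'.trans_isLittleO hh) fun h hh hlim => ?_
  have hrate : (fun n => ‖h n‖ ^ c) =o[atTop] fun n : ℕ => (n : ℝ) ^ (-(1 / 2 : ℝ)) :=
    (hh.norm_left.rpow hc (Eventually.of_forall fun n => by positivity)).congr_right
      (natCast_rpow_neg_one_div_two_mul_rpow hc.ne')
  refine (hπ.comp_tendsto hlim).trans_isLittleO (hrate.congr_left fun n => ?_)
  rw [Function.comp_apply, add_sub_cancel_left]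

theorem DDQMAt.locallyMimicked_of_isC2SubmanifoldAt (hθ : m.DDQMAt θ) (hA : A ⊆ m.Θ)
    (hB : B ⊆ m.Θ) (hA₂ : IsC2SubmanifoldAt A θ) (hB₂ : IsC2SubmanifoldAt B θ)
    (hAB : CEquivalentAt 1 A B θ) :
    m.LocallyMimicked A B θ (fun h => h =o[atTop] fun n : ℕ => (n : ℝ) ^ (-(1 / 4 : ℝ))) := by
  obtain ⟨π, hπB, hπθ, hπ⟩ := hAB.exists_map_isBigO_sq hA₂ hB₂
  refine hθ.locallyMimicked hA hB hπB hπθ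
    (fun h hh => hh.trans_tendsto (tendsto_natCast_rpow_neg (by positivity)))
    (fun h h' hh hh' => hh'.trans_isLittleO hh) fun h hh hlim => ?_
  have hrate : (fun n => ‖h n‖ ^ 2) =o[atTop] fun n : ℕ => (n : ℝ) ^ (-(1 / 2 : ℝ)) := by
    refine (hh.norm_left.pow two_pos).congr_right fun n => ?_
    rw [← Real.rpow_mul_natCast n.cast_nonneg]
    norm_num
  refine (hπ.comp_tendsto hlim).trans_isLittleO (hrate.congr_left fun n => ?_)
  rw [Function.comp_apply, add_sub_cancel_left]

end DominatedModel

theorem mainTheorem4 {k : ℕ} {X : Type*} [MeasurableSpace X] (m : DominatedModel k X)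
    (θ : EuclideanSpace ℝ (Fin k)) (hθ : m.DDQMAt θ)
    (M₁ M₂ : Set (EuclideanSpace ℝ (Fin k))) (hM₁ : M₁ ⊆ m.Θ) (hM₂ : M₂ ⊆ m.Θ) :
    (∀ c : ℝ, 0 < c → CEquivalentAt c M₁ M₂ θ →
      m.CannotDistinguish M₁ M₂ θ
        (fun h => h =O[atTop] fun n : ℕ => (n : ℝ) ^ (-(1 / (2 * c))))) ∧
    (∀ c : ℝ, 0 < c → CNearEquivalentAt c M₁ M₂ θ →
      m.CannotDistinguish M₁ M₂ θ
        (fun h => h =o[atTop] fun n : ℕ => (n : ℝ) ^ (-(1 / (2 * c))))) ∧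
    (IsC2SubmanifoldAt M₁ θ → IsC2SubmanifoldAt M₂ θ → CEquivalentAt 1 M₁ M₂ θ →
      m.CannotDistinguish M₁ M₂ θ
        (fun h => h =o[atTop] fun n : ℕ => (n : ℝ) ^ (-(1 / 4 : ℝ)))) := by
  refine ⟨fun c hc h => ⟨?_, ?_⟩, fun c hc h => ⟨?_, ?_⟩, fun h₁ h₂ h => ⟨?_, ?_⟩⟩
  · exact hθ.locallyMimicked_of_cEquivalentAt hM₁ hM₂ hc h
  · exact hθ.locallyMimicked_of_cEquivalentAt hM₂ hM₁ hc h.symm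
  · exact hθ.locallyMimicked_of_cNearEquivalentAt hM₁ hM₂ hc h
  · exact hθ.locallyMimicked_of_cNearEquivalentAt hM₂ hM₁ hc h.symm
  · exact hθ.locallyMimicked_of_isC2SubmanifoldAt hM₁ hM₂ h₁ h₂ h
  · exact hθ.locallyMimicked_of_isC2SubmanifoldAt hM₂ hM₁ h₂ h₁ h.symm
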